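/- Let $\mathbb{M}\subset\mathbb{R}^n$ be a compact embedded $\mathcal{C}^2$ submanifold (without boundary, possibly nonconvex) with positive reach $\tau\in(0,\infty]$, where $$\tau=\sup\{r>0:\ \text{every } y\in\mathbb{R}^n \text{ with } \mathrm{dist}(y,\mathbb{M})<r \text{ has a unique nearest point in } \mathbb{M}\}.$$ Let $A:\mathbb{R}^n\to\mathbb{R}^d$ be linear with maximal singular value $\sigma_{\max}$, and suppose that for some $0<\mu\le L<\infty$ $$\mu\|y_1-y_2\|\le\|Ay_1-Ay_2\|\le L\|y_1-y_2\|\qquad\text{for all } y_1,y_2\in\mathbb{M}.$$ Define the admissible set of observations $$\mathbb{X}=\Big\{Ay_*+w:\ y_*\in\mathbb{M},\ w\in\mathbb{R}^d,\ \|w\|<\tfrac{1}{80}\,\tfrac{\mu^5}{\sigma_{\max}^2L^2}\,\tau\Big\},$$ where the bound on $\|w\|$ is read as $+\infty$ if $\tau=\infty$. Then there exist $\alpha,\beta>0$, not depending on $x$, such that for every $x\in\mathbb{X}$ the problem $$\min_{y,z\in\mathbb{R}^n}\ \tfrac12\|x-Ay\|^2+\tfrac{\alpha}{2}\,\mathrm{dist}^2(z,\mathbb{M})+\tfrac{\beta}{2}\|y-z\|^2$$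 has a unique minimizer $(\hat y,\hat z)$, and the solution map $\mathcal{F}_{1b}:\mathbb{X}\to\mathbb{R}^n$, $x\mapsto\hat y$, is locally Lipschitz on $\mathbb{X}$: every $x\in\mathbb{X}$ has a neighborhood in $\mathbb{X}$ on which $\mathcal{F}_{1b}$ is Lipschitz. -/

import Mathlib

open Set Topology
open scoped ENNReal

noncomputable section

/-- `M` is a `k`-dimensional embedded `C²` submanifold (without boundary) of the normed space `E`:
around each of its points there is a `C²` diffeomorphism `Φ` between open subsets of `E`
that flattens `M` onto a `k`-dimensional linear subspace `V`. -/
def IsC2Submanifold {E : Type*} [NormedAddCommGroup E] [NormedSpace ℝ E]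
    (k : ℕ) (M : Set E) : Prop :=
  ∀ p ∈ M, ∃ (V : Submodule ℝ E) (Φ : OpenPartialHomeomorph E E),
    Module.finrank ℝ V = k ∧ p ∈ Φ.source ∧
    ContDiffOn ℝ 2 Φ Φ.source ∧ ContDiffOn ℝ 2 Φ.symm Φ.target ∧
    ∀ y ∈ Φ.source, y ∈ M ↔ Φ y ∈ V

/-- The reach of `M`: the supremum, in `[0, ∞]`, of all radii `r > 0` such that every point at
distance less than `r` from `M` has exactly one nearest point in `M`. -/
def reach {E : Type*} [NormedAddCommGroup E] (M : Set E) : ℝ≥0∞ :=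
  sSup (ENNReal.ofReal '' {r : ℝ | 0 < r ∧ ∀ y : E, Metric.infDist y M < r →
    ∃! z : E, z ∈ M ∧ ‖y - z‖ = Metric.infDist y M})

/-- `A` is `(μ, L)`-bi-Lipschitz when restricted to `M`. -/
def IsBiLipschitzOn {E F : Type*} [NormedAddCommGroup E] [NormedAddCommGroup F]
    (μ L : ℝ) (A : E → F) (M : Set E) : Prop :=
  0 < μ ∧ μ ≤ L ∧ ∀ y₁ ∈ M, ∀ y₂ ∈ M,
    μ * ‖y₁ - y₂‖ ≤ ‖A y₁ - A y₂‖ ∧ ‖A y₁ - A y₂‖ ≤ L * ‖y₁ - y₂‖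

/-- The maximal singular value of a linear map (singular values are listed in decreasing order). -/
def sigmaMax {n d : ℕ}
    (A : EuclideanSpace ℝ (Fin n) →ₗ[ℝ] EuclideanSpace ℝ (Fin d)) : ℝ :=
  A.singularValues 0

/-- The admissible observations `x = A y + w` with `y ∈ M` and
`‖w‖ < μ ^ 5 / (80 σ_max ^ 2 L ^ 2) * τ`, where `τ` is the reach of `M`. The bound is computed in
`[0, ∞]`, because `τ = ∞` when `M` is a single point; in particular it is `∞` when `σ_max = 0`,
which under the bi-Lipschitz condition also forces `M` to be a single point. -/
def admissibleSet {n d : ℕ} (M : Set (EuclideanSpace ℝ (Fin n)))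
    (A : EuclideanSpace ℝ (Fin n) →ₗ[ℝ] EuclideanSpace ℝ (Fin d)) (μ L : ℝ) :
    Set (EuclideanSpace ℝ (Fin d)) :=
  {x | ∃ y ∈ M, ∃ w : EuclideanSpace ℝ (Fin d), x = A y + w ∧
    ENNReal.ofReal ‖w‖ <
      ENNReal.ofReal (μ ^ 5) / ENNReal.ofReal (80 * sigmaMax A ^ 2 * L ^ 2) * reach M}

/-- The variable-splitting objective
`(y, z) ↦ ½‖x - A y‖² + (α/2) dist(z, M)² + (β/2)‖y - z‖²`. -/
def splitObjective {n d : ℕ} (M : Set (EuclideanSpace ℝ (Fin n)))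
    (A : EuclideanSpace ℝ (Fin n) →ₗ[ℝ] EuclideanSpace ℝ (Fin d)) (α β : ℝ)
    (x : EuclideanSpace ℝ (Fin d))
    (q : EuclideanSpace ℝ (Fin n) × EuclideanSpace ℝ (Fin n)) : ℝ :=
  1 / 2 * ‖x - A q.1‖ ^ 2 + α / 2 * Metric.infDist q.2 M ^ 2 + β / 2 * ‖q.1 - q.2‖ ^ 2

end

/-!
The splitting is harmless: taking `α = β = 2γ` and completing the square in `z`, the minimization
over `z` replaces `z` by the midpoint of `y` and a point `p ∈ M`, and the problem becomes that of
minimizing `G(y, p) = ½‖x - A y‖² + (γ/2)‖y - p‖²` over `y` arbitrary and `p ∈ M`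
(`splitObjective_eq`, `splitObjective_le`). We take `γ = σ_max² + 1`.

At a minimizer `(y, p)` of `G`, stationarity in `y` turns the expansion of the quadratic `G` into
`G(y + u, p + v) - G(y, p) = ½ (‖A u‖² + γ‖u - v‖²) - γ⟪v, y - p⟫`, and it gives
`γ‖y - p‖ ≤ σ_max ‖x - A y‖ ≤ σ_max ‖w‖`. Thus `y` is close to `M`, and `p` is a nearest point to
`y`, so Federer's inequality `2s⟪y - p, q - p⟫ ≤ ‖y - p‖‖q - p‖²` for `q ∈ M` and `s < reach M`
(`two_mul_inner_le_of_unique_nearest`) bounds the only term that could destroy convexity. As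
`‖A v‖ ≥ μ‖v‖` for differences `v` of points of `M`, and `γ ≥ σ_max²`, the positive quadratic part
is at least `(μ²/4)‖v‖²`, and the smallness of `w` lets it absorb that term. Hence `G` grows
quadratically away from the minimizer (`quadratic_growth`), which gives uniqueness, and comparing
the growth at the minimizers for two observations gives a Lipschitz bound for `x ↦ y`, uniform on
the whole admissible set.

Federer's inequality is obtained without a gradient flow. Where nearest points are unique, the
distance to `M` can locally be increased at a rate arbitrarily close to `1`
(`exists_infDist_ascent`). A maximality argument then leads from `y` to a point `b` at distance
exactly `s` from `M` with `‖b - y‖` not exceeding the gain in distance. Equality in the triangle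
inequality puts `b` on the ray from `p` through `y`, so the ball of radius `s` about this point of
the normal ray has no point of `M` in its interior.
-/

/-! ### The distance to a set with unique nearest points -/

section Reach

variable {E : Type*} [NormedAddCommGroup E] {M : Set E}

theorem infDist_le_norm_sub {a q : E} (hq : q ∈ M) : Metric.infDist a M ≤ ‖a - q‖ := by
  simpa [dist_eq_norm] using Metric.infDist_le_dist_of_mem (x := a) hq

theorem IsCompact.exists_norm_sub_eq_infDist (hM : IsCompact M) (hne : M.Nonempty) (a : E) :
    ∃ p ∈ M, ‖a - p‖ = Metric.infDist a M := by
  obtain ⟨p, hp, h⟩ := hM.exists_infDist_eq_dist hne a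
  exact ⟨p, hp, by rw [h, dist_eq_norm]⟩

theorem infDist_sub_infDist_le (a b : E) :
    Metric.infDist b M - Metric.infDist a M ≤ ‖b - a‖ := by
  have := Metric.infDist_le_infDist_add_dist (s := M) (x := b) (y := a)
  rw [dist_eq_norm] at this
  linarith

/-- The empty set has reach `0`: it has no nearest points at all. -/
theorem nonempty_of_reach_pos (h : 0 < reach M) : M.Nonempty := by
  obtain ⟨_, ⟨r, ⟨hr0, hr⟩, rfl⟩, -⟩ := lt_sSup_iff.1 h
  by_contra hM
  rw [not_nonempty_iff_eq_empty] at hM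
  subst hM
  obtain ⟨z, ⟨hz, -⟩, -⟩ := hr 0 (by simpa using hr0)
  exact hz

variable [InnerProductSpace ℝ E]

/-- If the nearest point `p` to `a ∉ M` is unique, then the distance to `M` increases at a rate
close to `1` when moving from `a` away from `p`: the points of `M` nearest to the moved point are
close to `p`, by compactness. -/
theorem exists_infDist_ascent (hM : IsCompact M) {a p : E} (hp : p ∈ M)
    (hpa : ‖a - p‖ = Metric.infDist a M) (hpos : 0 < Metric.infDist a M)
    (huniq : ∀ q ∈ M, ‖a - q‖ = Metric.infDist a M → q = p)
    {c δ : ℝ} (hc0 : 0 < c) (hc1 : c < 1) (hδ : 0 < δ) :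
    ∃ b, 0 < ‖b - a‖ ∧ ‖b - a‖ < δ ∧
      c * ‖b - a‖ ≤ Metric.infDist b M - Metric.infDist a M := by
  set D := Metric.infDist a M with hD
  set v : E := D⁻¹ • (a - p) with hv
  have hvn : ‖v‖ = 1 := by
    rw [hv, norm_smul, hpa, norm_inv, Real.norm_of_nonneg hpos.le, inv_mul_cancel₀ hpos.ne']
  have hpv : inner ℝ (a - p) v = D := by
    rw [hv, inner_smul_right, real_inner_self_eq_norm_sq, hpa]
    field_simp
  obtain ⟨ε, hε, hclose⟩ : ∃ ε > 0, ∀ q ∈ M, ‖a - q‖ < D + ε → c * D < inner ℝ (a - q) v := by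
    have hK : IsCompact (M ∩ {q | inner ℝ (a - q) v ≤ c * D}) :=
      hM.inter_right (isClosed_le (by fun_prop) continuous_const)
    rcases (M ∩ {q | inner ℝ (a - q) v ≤ c * D}).eq_empty_or_nonempty with he | hne
    · refine ⟨1, one_pos, fun q hq _ => ?_⟩
      by_contra hcon
      exact (he ▸ (⟨hq, not_lt.1 hcon⟩ : q ∈ M ∩ {q | inner ℝ (a - q) v ≤ c * D}) : q ∈ (∅ : Set E))
    · obtain ⟨q₀, hq₀, hmin⟩ := hK.exists_isMinOn hne
        (f := fun q => ‖a - q‖) (by fun_prop)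
      have h1 : D ≤ ‖a - q₀‖ := infDist_le_norm_sub hq₀.1
      have h2 : D ≠ ‖a - q₀‖ := by
        intro h
        have := hq₀.2
        rw [huniq q₀ hq₀.1 h.symm, mem_ofPred_eq, hpv] at this
        nlinarith
      refine ⟨‖a - q₀‖ - D, sub_pos.2 (lt_of_le_of_ne h1 h2), fun q hq hlt => ?_⟩
      by_contra hcon
      have := isMinOn_iff.1 hmin q ⟨hq, not_lt.1 hcon⟩
      linarith
  obtain ⟨t, ht0, ht⟩ := exists_between (lt_min hδ (half_pos hε))
  have htδ := ht.trans_le (min_le_left _ _)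
  have htε := ht.trans_le (min_le_right _ _)
  have hba : ‖a + t • v - a‖ = t := by
    rw [add_sub_cancel_left, norm_smul, hvn, Real.norm_of_nonneg ht0.le, mul_one]
  refine ⟨a + t • v, by rwa [hba], by rwa [hba], ?_⟩
  rw [hba]
  obtain ⟨q, hq, hqb⟩ := hM.exists_norm_sub_eq_infDist ⟨p, hp⟩ (a + t • v)
  have h1 := infDist_sub_infDist_le (M := M) a (a + t • v)
  rw [hba, ← hD] at h1
  have h2 : ‖a - q‖ ≤ ‖a + t • v - q‖ + t := by
    have := norm_sub_le (a + t • v - q) (a + t • v - a)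
    rwa [hba, sub_sub_sub_cancel_left] at this
  have h3 := hclose q hq (by linarith)
  have h4 : D ≤ ‖a - q‖ := infDist_le_norm_sub hq
  have h5 : ‖a + t • v - q‖ ^ 2 = ‖a - q‖ ^ 2 + 2 * t * inner ℝ (a - q) v + t ^ 2 := by
    rw [show a + t • v - q = (a - q) + t • v by abel, norm_add_sq_real, norm_smul, hvn,
      inner_smul_right, Real.norm_of_nonneg ht0.le]
    ring
  have h6 : D + c * t ≤ ‖a + t • v - q‖ := by
    refine (abs_le_of_sq_le_sq' ?_ (norm_nonneg _)).2
    rw [h5]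
    have : D ^ 2 ≤ ‖a - q‖ ^ 2 := by gcongr
    have : t * (c * D) ≤ t * inner ℝ (a - q) v := by gcongr
    have : (c * t) ^ 2 ≤ t ^ 2 := by
      have : c * t ≤ t := by nlinarith
      gcongr
    nlinarith
  linarith

/-- Starting from `a`, any distance `s < r` to `M` can be reached with an average rate of increase
at least `c < 1`: among the points reached at this rate, one that is farthest from `M` has
distance `s`. -/
theorem exists_infDist_eq_of_rate [ProperSpace E] (hM : IsCompact M) {r : ℝ}
    (hr : ∀ y : E, Metric.infDist y M < r → ∃! z : E, z ∈ M ∧ ‖y - z‖ = Metric.infDist y M)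
    {a : E} (hpos : 0 < Metric.infDist a M) {s : ℝ} (has : Metric.infDist a M ≤ s) (hsr : s < r)
    {c : ℝ} (hc0 : 0 < c) (hc1 : c < 1) :
    ∃ b, Metric.infDist b M = s ∧ c * ‖b - a‖ ≤ s - Metric.infDist a M := by
  set K : Set E := {b | c * ‖b - a‖ ≤ Metric.infDist b M - Metric.infDist a M} ∩
    {b | Metric.infDist b M ≤ s} with hK
  have hcont : Continuous fun b => Metric.infDist b M := Metric.continuous_infDist_pt M
  have hcompact : IsCompact K := by
    refine (isCompact_closedBall a ((s - Metric.infDist a M) / c)).of_isClosed_subset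
      ((isClosed_le (by fun_prop) (by fun_prop)).inter (isClosed_le hcont continuous_const)) ?_
    rintro b ⟨h1, h2⟩
    rw [mem_ofPred_eq] at h1 h2
    rw [mem_closedBall_iff_norm, le_div_iff₀ hc0]
    linarith
  obtain ⟨b, ⟨hb1, hb2⟩, hmax⟩ :=
    hcompact.exists_isMaxOn ⟨a, by simp, has⟩ hcont.continuousOn
  rw [mem_ofPred_eq] at hb1 hb2
  have hbs : Metric.infDist b M = s := by
    by_contra hne
    have hlt : Metric.infDist b M < s := lt_of_le_of_ne hb2 hne
    obtain ⟨p, ⟨hp, hpb⟩, huniq⟩ := hr b (hlt.trans hsr)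
    have hbpos : 0 < Metric.infDist b M := by
      have : 0 ≤ c * ‖b - a‖ := by positivity
      linarith
    obtain ⟨b', h0, hδ, hrate⟩ := exists_infDist_ascent hM hp hpb hbpos
      (fun q hq h => huniq q ⟨hq, h⟩) hc0 hc1 (sub_pos.2 hlt)
    have htri : c * ‖b' - a‖ ≤ c * ‖b' - b‖ + c * ‖b - a‖ := by
      rw [← mul_add]
      gcongr
      simpa using norm_add_le (b' - b) (b - a)
    have hlip := infDist_sub_infDist_le (M := M) b b'
    have hmem : b' ∈ K := ⟨by rw [mem_ofPred_eq]; linarith, by rw [mem_ofPred_eq]; linarith⟩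
    have := isMaxOn_iff.1 hmax b' hmem
    have : 0 < c * ‖b' - b‖ := by positivity
    linarith
  exact ⟨b, hbs, by linarith⟩

/-- **Federer's inequality**: if all points at distance less than `r` from `M` have a unique
nearest point in `M`, and `p` is the nearest point to `a`, then for `s < r` the open ball of
radius `s` touching `M` at `p` and centred on the ray from `p` through `a` does not meet `M`. -/
theorem two_mul_inner_le_of_unique_nearest [ProperSpace E] (hM : IsCompact M) {r : ℝ}
    (hr : ∀ y : E, Metric.infDist y M < r → ∃! z : E, z ∈ M ∧ ‖y - z‖ = Metric.infDist y M)
    {a p : E} (hp : p ∈ M) (hpa : ‖a - p‖ = Metric.infDist a M)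
    {s : ℝ} (has : Metric.infDist a M < s) (hsr : s < r) {q : E} (hq : q ∈ M) :
    2 * s * inner ℝ (a - p) (q - p) ≤ ‖a - p‖ * ‖q - p‖ ^ 2 := by
  rcases (norm_nonneg (a - p)).eq_or_lt with h0 | hpos
  · have : a - p = 0 := norm_eq_zero.1 h0.symm
    simp [this]
  rw [hpa] at hpos
  have hreach := fun {c : ℝ} => exists_infDist_eq_of_rate hM hr hpos has.le hsr (c := c)
  set D := Metric.infDist a M with hD
  -- A point at distance `s` from `M` closest to `a` realizes the optimal rate `1`.
  obtain ⟨b, hbs, hba⟩ : ∃ b, Metric.infDist b M = s ∧ ‖b - a‖ ≤ s - D := by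
    have hcompact : IsCompact ({b | Metric.infDist b M = s} ∩ Metric.closedBall a (2 * (s - D))) :=
      (isCompact_closedBall a _).inter_left
        (isClosed_eq (Metric.continuous_infDist_pt M) continuous_const)
    obtain ⟨b₁, hb₁, hb₁a⟩ := hreach (c := 1 / 2) (by norm_num) (by norm_num)
    obtain ⟨b, ⟨hbs, -⟩, hmin⟩ := hcompact.exists_isMinOn
      ⟨b₁, hb₁, by rw [mem_closedBall_iff_norm]; linarith⟩ (f := fun b => ‖b - a‖) (by fun_prop)
    refine ⟨b, hbs, ?_⟩
    by_contra! hlt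
    have he : 0 < s - D := sub_pos.2 has
    have hB : 0 < ‖b - a‖ := he.trans hlt
    have hfrac : (s - D) / ‖b - a‖ < 1 := (div_lt_one hB).2 hlt
    have hfrac0 : 0 < (s - D) / ‖b - a‖ := div_pos he hB
    obtain ⟨b', hb', hb'a⟩ := hreach (c := (1 + (s - D) / ‖b - a‖) / 2) (by linarith) (by linarith)
    have hle : ‖b - a‖ ≤ ‖b' - a‖ := by
      refine isMinOn_iff.1 hmin b' ⟨hb', ?_⟩
      rw [mem_closedBall_iff_norm]
      nlinarith [norm_nonneg (b' - a)]
    have h1 : (1 + (s - D) / ‖b - a‖) / 2 * ‖b - a‖ ≤ s - D :=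
      (mul_le_mul_of_nonneg_left hle (by linarith)).trans hb'a
    have h2 : (1 + (s - D) / ‖b - a‖) / 2 * ‖b - a‖ = (‖b - a‖ + (s - D)) / 2 := by
      field_simp
    linarith
  have hsum : b - p = (b - a) + (a - p) := by abel
  have hbp : s ≤ ‖b - p‖ := hbs ▸ infDist_le_norm_sub hp
  have hbq : s ≤ ‖b - q‖ := hbs ▸ infDist_le_norm_sub hq
  have hbp' : ‖b - p‖ ≤ s := by
    rw [hsum]
    have := norm_add_le (b - a) (a - p)
    linarith
  have hs : 0 < s := hpos.trans has
  -- Equality in the triangle inequality: `b` lies on the ray from `p` through `a`.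
  have hray : D • (b - p) = s • (a - p) := by
    have h1 : s ^ 2 ≤ ‖b - a‖ ^ 2 + 2 * inner ℝ (b - a) (a - p) + D ^ 2 := by
      have : s ^ 2 ≤ ‖b - p‖ ^ 2 := by gcongr
      rwa [hsum, norm_add_sq_real, hpa] at this
    have h2 : ‖b - a‖ ^ 2 ≤ (s - D) ^ 2 := by gcongr
    have h3 : ‖D • (b - a) - (s - D) • (a - p)‖ ^ 2 ≤ 0 := by
      rw [norm_sub_sq_real, norm_smul, norm_smul, inner_smul_left, inner_smul_right, hpa,
        mul_pow, mul_pow, Real.norm_eq_abs, Real.norm_eq_abs, sq_abs, sq_abs]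
      simp only [conj_trivial]
      have h4 : D * (s - D) ≤ inner ℝ (b - a) (a - p) := by nlinarith
      have h5 : D * (s - D) * (D * (s - D)) ≤ D * (s - D) * inner ℝ (b - a) (a - p) :=
        mul_le_mul_of_nonneg_left h4 (mul_nonneg hpos.le (sub_nonneg.2 has.le))
      have h6 : D ^ 2 * ‖b - a‖ ^ 2 ≤ D ^ 2 * (s - D) ^ 2 := by gcongr
      linarith
    have h4 : D • (b - a) - (s - D) • (a - p) = 0 := by
      rw [← norm_eq_zero]
      exact pow_eq_zero_iff two_ne_zero |>.1 (le_antisymm h3 (by positivity))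
    rw [sub_eq_zero] at h4
    rw [hsum, smul_add, h4, sub_smul]
    abel
  have hin : 2 * inner ℝ (b - p) (q - p) ≤ ‖q - p‖ ^ 2 := by
    have h1 : s ^ 2 ≤ ‖b - q‖ ^ 2 := by gcongr
    have h2 : ‖b - p‖ ^ 2 ≤ s ^ 2 := by gcongr
    rw [show b - q = (b - p) - (q - p) by abel, norm_sub_sq_real] at h1
    linarith
  have hin' : D * inner ℝ (b - p) (q - p) = s * inner ℝ (a - p) (q - p) := by
    rw [← real_inner_smul_left, hray, real_inner_smul_left]
  rw [hpa]
  nlinarith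

end Reach

/-! ### The largest singular value -/

theorem norm_apply_le_sigmaMax {n d : ℕ}
    (A : EuclideanSpace ℝ (Fin n) →ₗ[ℝ] EuclideanSpace ℝ (Fin d)) (v : EuclideanSpace ℝ (Fin n)) :
    ‖A v‖ ≤ sigmaMax A * ‖v‖ := by
  have hσ : 0 ≤ sigmaMax A := A.singularValues_nonneg 0
  refine (abs_le_of_sq_le_sq' ?_ (by positivity)).2
  have hS := A.isSymmetric_adjoint_comp_self
  set b := hS.eigenvectorBasis rfl with hb
  have h1 : ‖A v‖ ^ 2 = ∑ i, hS.eigenvalues rfl i * b.repr v i ^ 2 := by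
    rw [← real_inner_self_eq_norm_sq, ← LinearMap.adjoint_inner_left, ← LinearMap.comp_apply,
      ← b.repr.inner_map_map, PiLp.inner_apply]
    refine Finset.sum_congr rfl fun i _ => ?_
    rw [hb, hS.eigenvectorBasis_apply_self_apply]
    simp
    ring
  have h2 : ‖v‖ ^ 2 = ∑ i, b.repr v i ^ 2 := by
    rw [← b.repr.norm_map, EuclideanSpace.real_norm_sq_eq]
  rw [h1, mul_pow, h2, Finset.mul_sum]
  refine Finset.sum_le_sum fun i _ => ?_
  gcongr
  rw [← A.sq_singularValues_fin rfl i, sigmaMax]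
  gcongr
  · exact A.singularValues_nonneg _
  · exact A.singularValues_antitone (Nat.zero_le _)

/-! ### The reduced objective -/

section Reduced

variable {E F : Type*} [NormedAddCommGroup E] [InnerProductSpace ℝ E]
  [NormedAddCommGroup F] [InnerProductSpace ℝ F]

/-- The objective in `y` and `p ∈ M` that remains of the split objective with `α = β = 2γ` once
the variable `z` has been eliminated. -/
noncomputable def reducedObjective (A : E →ₗ[ℝ] F) (γ : ℝ) (x : F) (y p : E) : ℝ :=
  1 / 2 * ‖x - A y‖ ^ 2 + γ / 2 * ‖y - p‖ ^ 2

/-- `(y, p)` minimizes the reduced objective subject to `p ∈ M`. -/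
def IsReducedMin (M : Set E) (A : E →ₗ[ℝ] F) (γ : ℝ) (x : F) (y p : E) : Prop :=
  p ∈ M ∧ ∀ y', ∀ p' ∈ M, reducedObjective A γ x y p ≤ reducedObjective A γ x y' p'

variable {M : Set E} {A : E →ₗ[ℝ] F} {γ : ℝ} {x : F} {y p : E}

theorem reducedObjective_add (u v : E) :
    reducedObjective A γ x (y + u) (p + v) = reducedObjective A γ x y p
      + 1 / 2 * (‖A u‖ ^ 2 + γ * ‖u - v‖ ^ 2)
      - inner ℝ (A u) (x - A y) + γ * inner ℝ (u - v) (y - p) := by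
  have h1 : x - A (y + u) = (x - A y) - A u := by rw [map_add]; abel
  have h2 : y + u - (p + v) = (y - p) + (u - v) := by abel
  simp only [reducedObjective]
  rw [h1, h2, norm_sub_sq_real, norm_add_sq_real, real_inner_comm (A u), real_inner_comm (u - v)]
  ring

/-- The lower bound on `A v` makes the quadratic part of the reduced objective control the
displacement `v` in `M`, because `‖A (u - v)‖ ≤ σ ‖u - v‖` is controlled as well. -/
theorem sq_mul_norm_sq_le {σ μ : ℝ} (hσγ : σ ^ 2 ≤ γ) (hμ : 0 < μ)
    (hA : ∀ v, ‖A v‖ ≤ σ * ‖v‖) {v : E} (hv : μ * ‖v‖ ≤ ‖A v‖) (u : E) :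
    μ ^ 2 * ‖v‖ ^ 2 ≤ 2 * (‖A u‖ ^ 2 + γ * ‖u - v‖ ^ 2) := by
  have h1 : ‖A v‖ ≤ ‖A u‖ + ‖A (u - v)‖ := by
    have := norm_sub_le (A u) (A (u - v))
    rwa [← map_sub, sub_sub_cancel] at this
  have h2 : (μ * ‖v‖) ^ 2 ≤ (‖A u‖ + ‖A (u - v)‖) ^ 2 := by
    gcongr
    exact hv.trans h1
  have h3 : ‖A (u - v)‖ ^ 2 ≤ γ * ‖u - v‖ ^ 2 := by
    have : ‖A (u - v)‖ ^ 2 ≤ (σ * ‖u - v‖) ^ 2 := by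
      gcongr
      exact hA _
    rw [mul_pow] at this
    exact this.trans (by gcongr)
  have h4 := sq_nonneg (‖A u‖ - ‖A (u - v)‖)
  nlinarith

theorem exists_isReducedMin [FiniteDimensional ℝ E] (hM : IsCompact M) (hne : M.Nonempty)
    (hγ : 0 < γ) (x : F) : ∃ y p, IsReducedMin M A γ x y p := by
  have : ProperSpace E := FiniteDimensional.proper ℝ E
  have hA : Continuous A := A.continuous_of_finiteDimensional
  obtain ⟨p₀, hp₀⟩ := hne
  set m := reducedObjective A γ x p₀ p₀ with hm
  -- `G (y, p) ≤ m` forces `(γ / 2) ‖y - p‖ ^ 2 ≤ m`, and `p` ranges in a bounded set.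
  obtain ⟨R, hR⟩ := hM.isBounded.exists_norm_le
  set S := R + (m * 2 / γ + 1) with hS
  have hm0 : 0 ≤ m := by rw [hm, reducedObjective]; positivity
  have hmS : 0 ≤ m * 2 / γ := by positivity
  have hK : IsCompact (Metric.closedBall (0 : E) S ×ˢ M) := (isCompact_closedBall 0 S).prod hM
  have hp₀S : (p₀, p₀) ∈ Metric.closedBall (0 : E) S ×ˢ M := by
    refine ⟨?_, hp₀⟩
    rw [mem_closedBall_zero_iff]
    have := hR p₀ hp₀
    simp only
    linarith
  obtain ⟨⟨y, p⟩, ⟨-, hp⟩, hmin⟩ := hK.exists_isMinOn ⟨_, hp₀S⟩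
    (f := fun q : E × E => reducedObjective A γ x q.1 q.2)
    (by unfold reducedObjective; fun_prop)
  refine ⟨y, p, hp, fun y' p' hp' => ?_⟩
  by_cases hy' : ‖y'‖ ≤ S
  · exact isMinOn_iff.1 hmin (y', p') ⟨by simpa using hy', hp'⟩
  · have h1 : reducedObjective A γ x y p ≤ m := isMinOn_iff.1 hmin _ hp₀S
    have h2 : m * 2 / γ + 1 < ‖y' - p'‖ := by
      have := norm_sub_norm_le y' p'
      have := hR p' hp'
      linarith
    have h3 : m * 2 / γ ≤ ‖y' - p'‖ ^ 2 := by nlinarith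
    have h4 : m ≤ γ / 2 * ‖y' - p'‖ ^ 2 := by
      rw [div_le_iff₀ hγ] at h3
      linarith
    have h5 : 0 ≤ 1 / 2 * ‖x - A y'‖ ^ 2 := by positivity
    unfold reducedObjective at h1 ⊢
    linarith

namespace IsReducedMin

theorem stationary (h : IsReducedMin M A γ x y p) (hγ : 0 ≤ γ) (u : E) :
    inner ℝ (A u) (x - A y) = γ * inner ℝ u (y - p) := by
  set b := γ * inner ℝ u (y - p) - inner ℝ (A u) (x - A y) with hb
  set c := ‖A u‖ ^ 2 + γ * ‖u‖ ^ 2 with hc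
  have hc0 : 0 ≤ c := by positivity
  have hquad : ∀ t : ℝ, 0 ≤ t * b + t ^ 2 * c / 2 := by
    intro t
    have h1 := h.2 (y + t • u) p h.1
    have h2 := reducedObjective_add (A := A) (γ := γ) (x := x) (y := y) (p := p) (t • u) 0
    rw [add_zero, sub_zero, map_smul, inner_smul_left, inner_smul_left, norm_smul, norm_smul,
      mul_pow, mul_pow, Real.norm_eq_abs, sq_abs] at h2
    simp only [conj_trivial] at h2
    rw [hb, hc]
    linarith
  have h1 := hquad (-b / (c + 1))
  have h2 : -b / (c + 1) * b + (-b / (c + 1)) ^ 2 * c / 2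
      = -(b ^ 2 * (c + 2)) / (2 * (c + 1) ^ 2) := by
    field_simp
    ring
  rw [h2, div_nonneg_iff] at h1
  have h3 : b ^ 2 * (c + 2) ≤ 0 := by
    rcases h1 with h1 | h1
    · linarith
    · have : 0 < 2 * (c + 1) ^ 2 := by positivity
      linarith
  have h4 : b = 0 := by
    by_contra hne
    have : 0 < b ^ 2 * (c + 2) := by positivity
    linarith
  linarith

theorem norm_sub_eq_infDist (h : IsReducedMin M A γ x y p) (hM : IsCompact M) (hγ : 0 < γ) :
    ‖y - p‖ = Metric.infDist y M := by
  obtain ⟨q, hq, hqy⟩ := hM.exists_norm_sub_eq_infDist ⟨p, h.1⟩ y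
  refine le_antisymm ?_ (infDist_le_norm_sub h.1)
  rw [← hqy]
  have := h.2 y q hq
  unfold reducedObjective at this
  refine (abs_le_of_sq_le_sq' ?_ (norm_nonneg _)).2
  have : γ / 2 * ‖y - p‖ ^ 2 ≤ γ / 2 * ‖y - q‖ ^ 2 := by linarith
  exact le_of_mul_le_mul_left this (by positivity)

/-- The point `y` of a minimizer is close to `M`, since stationarity in `y` reads
`γ (y - p) = A* (x - A y)`, and the residual is at most that of any point of `M`. -/
theorem mul_norm_sub_le (h : IsReducedMin M A γ x y p) (hγ : 0 < γ) {σ : ℝ} (hσ : 0 ≤ σ)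
    (hA : ∀ v, ‖A v‖ ≤ σ * ‖v‖) {y₀ : E} (hy₀ : y₀ ∈ M) :
    γ * ‖y - p‖ ≤ σ * ‖x - A y₀‖ := by
  have hres : ‖x - A y‖ ≤ ‖x - A y₀‖ := by
    have h1 := h.2 y₀ y₀ hy₀
    simp only [reducedObjective, sub_self, norm_zero] at h1
    have h2 : 0 ≤ γ / 2 * ‖y - p‖ ^ 2 := by positivity
    refine (abs_le_of_sq_le_sq' ?_ (norm_nonneg _)).2
    linarith
  rcases (norm_nonneg (y - p)).eq_or_lt with h0 | hpos
  · rw [← h0, mul_zero]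
    positivity
  have h1 := h.stationary hγ.le (y - p)
  rw [real_inner_self_eq_norm_sq] at h1
  have h2 : γ * ‖y - p‖ ^ 2 ≤ σ * ‖y - p‖ * ‖x - A y₀‖ := by
    rw [← h1]
    refine (real_inner_le_norm _ _).trans ?_
    gcongr
    exact hA _
  refine le_of_mul_le_mul_right ?_ hpos
  linarith

/-- Quadratic growth at a minimizer `(y, p)`, in the presence of a bound on the curvature term. -/
theorem quadratic_growth (h : IsReducedMin M A γ x y p) (hγ : 0 < γ) {σ μ : ℝ}
    (hσγ : σ ^ 2 ≤ γ) (hμ : 0 < μ) (hA : ∀ v, ‖A v‖ ≤ σ * ‖v‖)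
    (hlow : ∀ q₁ ∈ M, ∀ q₂ ∈ M, μ * ‖q₁ - q₂‖ ≤ ‖A q₁ - A q₂‖)
    (hcurv : ∀ q ∈ M, γ * inner ℝ (y - p) (q - p) ≤ μ ^ 2 / 8 * ‖q - p‖ ^ 2)
    (y' : E) {q : E} (hq : q ∈ M) :
    reducedObjective A γ x y p
        + 1 / 4 * (‖A (y' - y)‖ ^ 2 + γ * ‖(y' - y) - (q - p)‖ ^ 2)
      ≤ reducedObjective A γ x y' q := by
  have h1 := reducedObjective_add (A := A) (γ := γ) (x := x) (y := y) (p := p) (y' - y) (q - p)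
  rw [add_sub_cancel, add_sub_cancel, h.stationary hγ.le, inner_sub_left (y' - y) (q - p)] at h1
  have h2 := hcurv q hq
  rw [real_inner_comm] at h2
  have h3 := sq_mul_norm_sq_le hσγ hμ hA (v := q - p)
    (by simpa using hlow q hq p h.1) (y' - y)
  linarith

/-- Adding the growth inequalities at the minimizers for two observations, all terms cancel but a
bilinear one. -/
theorem norm_sq_add_le_of_growth {x₁ x₂ : F} {y₁ y₂ p₁ p₂ : E} (hγ : 0 ≤ γ)
    (h₁ : reducedObjective A γ x₁ y₁ p₁
        + 1 / 4 * (‖A (y₂ - y₁)‖ ^ 2 + γ * ‖(y₂ - y₁) - (p₂ - p₁)‖ ^ 2)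
      ≤ reducedObjective A γ x₁ y₂ p₂)
    (h₂ : reducedObjective A γ x₂ y₂ p₂
        + 1 / 4 * (‖A (y₁ - y₂)‖ ^ 2 + γ * ‖(y₁ - y₂) - (p₁ - p₂)‖ ^ 2)
      ≤ reducedObjective A γ x₂ y₁ p₁) :
    ‖A (y₂ - y₁)‖ ^ 2 + γ * ‖(y₂ - y₁) - (p₂ - p₁)‖ ^ 2 ≤ 4 * ‖x₂ - x₁‖ ^ 2 := by
  have e1 : ‖A (y₁ - y₂)‖ = ‖A (y₂ - y₁)‖ := by rw [← neg_sub, map_neg, norm_neg]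
  have e2 : ‖(y₁ - y₂) - (p₁ - p₂)‖ = ‖(y₂ - y₁) - (p₂ - p₁)‖ := by
    rw [← norm_neg]
    congr 1
    abel
  rw [e1, e2] at h₂
  have e3 : ‖x₁ - A y₂‖ ^ 2 - ‖x₁ - A y₁‖ ^ 2 + (‖x₂ - A y₁‖ ^ 2 - ‖x₂ - A y₂‖ ^ 2)
      = 2 * inner ℝ (x₂ - x₁) (A (y₂ - y₁)) := by
    simp only [norm_sub_sq_real, map_sub, inner_sub_left, inner_sub_right]
    ring
  have e4 := real_inner_le_norm (x₂ - x₁) (A (y₂ - y₁))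
  unfold reducedObjective at h₁ h₂
  set S := γ * ‖(y₂ - y₁) - (p₂ - p₁)‖ ^ 2 with hS
  have hS0 : 0 ≤ S := by positivity
  nlinarith [sq_nonneg (‖A (y₂ - y₁)‖ - 2 * ‖x₂ - x₁‖)]

end IsReducedMin

end Reduced

/-! ### Elimination of the splitting variable -/

section Split

variable {n d : ℕ} {M : Set (EuclideanSpace ℝ (Fin n))}
  {A : EuclideanSpace ℝ (Fin n) →ₗ[ℝ] EuclideanSpace ℝ (Fin d)} {γ : ℝ}
  {x : EuclideanSpace ℝ (Fin d)} {y z p : EuclideanSpace ℝ (Fin n)}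

theorem norm_sq_add_norm_sq_eq_midpoint {E : Type*} [NormedAddCommGroup E] [InnerProductSpace ℝ E]
    (y z p : E) :
    ‖z - p‖ ^ 2 + ‖y - z‖ ^ 2
      = 1 / 2 * ‖y - p‖ ^ 2 + 2 * ‖z - (1 / 2 : ℝ) • (y + p)‖ ^ 2 := by
  have h1 : y - p = (z - p) + (y - z) := by abel
  have h2 : z - (1 / 2 : ℝ) • (y + p) = (1 / 2 : ℝ) • ((z - p) - (y - z)) := by module
  rw [h2, norm_smul, mul_pow, h1, norm_add_sq_real, norm_sub_sq_real (z - p)]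
  norm_num
  ring

theorem splitObjective_eq (hz : ‖z - p‖ = Metric.infDist z M) :
    splitObjective M A (2 * γ) (2 * γ) x (y, z)
      = reducedObjective A γ x y p + 2 * γ * ‖z - (1 / 2 : ℝ) • (y + p)‖ ^ 2 := by
  have h := norm_sq_add_norm_sq_eq_midpoint y z p
  rw [splitObjective, reducedObjective, ← hz]
  linear_combination γ * h

theorem splitObjective_le (hγ : 0 ≤ γ) (hp : p ∈ M) :
    splitObjective M A (2 * γ) (2 * γ) x (y, (1 / 2 : ℝ) • (y + p))
      ≤ reducedObjective A γ x y p := by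
  have h := norm_sq_add_norm_sq_eq_midpoint y ((1 / 2 : ℝ) • (y + p)) p
  rw [sub_self, norm_zero] at h
  have h1 : Metric.infDist ((1 / 2 : ℝ) • (y + p)) M ^ 2 ≤ ‖(1 / 2 : ℝ) • (y + p) - p‖ ^ 2 :=
    pow_le_pow_left₀ Metric.infDist_nonneg (infDist_le_norm_sub hp) 2
  have h2 := mul_le_mul_of_nonneg_left h1 hγ
  rw [splitObjective, reducedObjective]
  linear_combination h2 + γ * h

theorem isMinOn_splitObjective_iff (hM : IsCompact M) (hne : M.Nonempty) (hγ : 0 < γ) :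
    IsMinOn (splitObjective M A (2 * γ) (2 * γ) x) univ (y, z) ↔
      ∃ p, IsReducedMin M A γ x y p ∧ z = (1 / 2 : ℝ) • (y + p) := by
  constructor
  · intro h
    obtain ⟨p, hp, hpz⟩ := hM.exists_norm_sub_eq_infDist hne z
    have key : ∀ y', ∀ p' ∈ M, reducedObjective A γ x y p
        + 2 * γ * ‖z - (1 / 2 : ℝ) • (y + p)‖ ^ 2 ≤ reducedObjective A γ x y' p' := by
      intro y' p' hp'
      rw [← splitObjective_eq hpz]
      exact (isMinOn_iff.1 h _ (mem_univ _)).trans (splitObjective_le hγ.le hp')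
    refine ⟨p, ⟨hp, fun y' p' hp' => ?_⟩, ?_⟩
    · have : 0 ≤ 2 * γ * ‖z - (1 / 2 : ℝ) • (y + p)‖ ^ 2 := by positivity
      linarith [key y' p' hp']
    · by_contra hz
      have : 0 < ‖z - (1 / 2 : ℝ) • (y + p)‖ := norm_pos_iff.2 (sub_ne_zero.2 hz)
      have : 0 < 2 * γ * ‖z - (1 / 2 : ℝ) • (y + p)‖ ^ 2 := by positivity
      linarith [key y p hp]
  · rintro ⟨p, hmin, rfl⟩
    rw [isMinOn_iff]
    rintro ⟨y', z'⟩ -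
    obtain ⟨p', hp', hpz'⟩ := hM.exists_norm_sub_eq_infDist hne z'
    rw [splitObjective_eq hpz']
    have : 0 ≤ 2 * γ * ‖z' - (1 / 2 : ℝ) • (y' + p')‖ ^ 2 := by positivity
    linarith [hmin.2 y' p' hp', splitObjective_le (A := A) (x := x) (y := y) hγ.le hmin.1]

/-! ### Admissible observations -/

/-- For an admissible noise level `‖w‖`, the radius `4 σ_max ‖w‖ / μ²`, for which Federer's
inequality yields the curvature bound required for quadratic growth, is below the reach. -/
theorem exists_radius_of_admissible {μ L : ℝ} (hμ : 0 < μ) (hμL : μ ≤ L) (hμσ : μ ≤ sigmaMax A)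
    {w : EuclideanSpace ℝ (Fin d)}
    (hw : ENNReal.ofReal ‖w‖ <
      ENNReal.ofReal (μ ^ 5) / ENNReal.ofReal (80 * sigmaMax A ^ 2 * L ^ 2) * reach M) :
    ∃ r, 4 * sigmaMax A * ‖w‖ / μ ^ 2 < r ∧ ∀ y, Metric.infDist y M < r →
      ∃! z, z ∈ M ∧ ‖y - z‖ = Metric.infDist y M := by
  set σ := sigmaMax A with hσdef
  have hσ : 0 < σ := hμ.trans_le hμσ
  have hL : 0 < L := hμ.trans_le hμL
  by_contra! hcon
  have hle : reach M ≤ ENNReal.ofReal (4 * σ * ‖w‖ / μ ^ 2) := by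
    refine sSup_le ?_
    rintro _ ⟨r, ⟨-, hr⟩, rfl⟩
    refine ENNReal.ofReal_le_ofReal (not_lt.1 fun hlt => ?_)
    obtain ⟨y, hy, hny⟩ := hcon r hlt
    exact hny (hr y hy)
  have h1 : ENNReal.ofReal ‖w‖ <
      ENNReal.ofReal (μ ^ 5 / (80 * σ ^ 2 * L ^ 2) * (4 * σ * ‖w‖ / μ ^ 2)) := by
    rw [ENNReal.ofReal_mul (by positivity), ENNReal.ofReal_div_of_pos (by positivity)]
    exact hw.trans_le (by gcongr)
  have h2 := (ENNReal.ofReal_lt_ofReal_iff_of_nonneg (norm_nonneg _)).1 h1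
  have h3 : μ ^ 5 / (80 * σ ^ 2 * L ^ 2) * (4 * σ * ‖w‖ / μ ^ 2)
      = (μ / σ) * (μ / L) ^ 2 * (‖w‖ / 20) := by
    field_simp
    ring
  have h4 : (μ / σ) * (μ / L) ^ 2 ≤ 1 := by
    have a1 : μ / σ ≤ 1 := (div_le_one hσ).2 hμσ
    have a2 : (μ / L) ^ 2 ≤ 1 := pow_le_one₀ (by positivity) ((div_le_one hL).2 hμL)
    exact mul_le_one₀ a1 (by positivity) a2
  rw [h3] at h2
  have h5 : (μ / σ) * (μ / L) ^ 2 * (‖w‖ / 20) ≤ 1 * (‖w‖ / 20) := by gcongr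
  linarith [norm_nonneg w]

theorem IsReducedMin.curvature_le {μ L : ℝ} (hM : IsCompact M) (hA : IsBiLipschitzOn μ L A M)
    (hx : x ∈ admissibleSet M A μ L) (h : IsReducedMin M A (sigmaMax A ^ 2 + 1) x y p)
    {q : EuclideanSpace ℝ (Fin n)} (hq : q ∈ M) :
    (sigmaMax A ^ 2 + 1) * inner ℝ (y - p) (q - p) ≤ μ ^ 2 / 8 * ‖q - p‖ ^ 2 := by
  obtain ⟨hμ, hμL, hbi⟩ := hA
  obtain ⟨y₀, hy₀, w, rfl, hw⟩ := hx
  rcases eq_or_ne q p with rfl | hqp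
  · simp
  have hqp' : 0 < ‖q - p‖ := norm_pos_iff.2 (sub_ne_zero.2 hqp)
  -- Two distinct points of `M` force `μ ≤ σ_max`, so that `σ_max ≠ 0`.
  have hμσ : μ ≤ sigmaMax A := by
    have h1 := (hbi q hq p h.1).1.trans ((map_sub A q p) ▸ norm_apply_le_sigmaMax A (q - p))
    exact le_of_mul_le_mul_right h1 hqp'
  obtain ⟨r, hr, hunique⟩ := exists_radius_of_admissible hμ hμL hμσ hw
  have hclose := h.mul_norm_sub_le (by positivity) (A.singularValues_nonneg 0)
    (norm_apply_le_sigmaMax A) hy₀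
  change _ ≤ sigmaMax A * _ at hclose
  rw [add_sub_cancel_left] at hclose
  set σ := sigmaMax A with hσdef
  have hσ : 0 < σ := hμ.trans_le hμσ
  have hdist := h.norm_sub_eq_infDist hM (by positivity)
  rcases (norm_nonneg w).eq_or_lt with hw0 | hwpos
  · have h0 : ‖y - p‖ = 0 := by
      rw [← hw0, mul_zero] at hclose
      exact le_antisymm (nonpos_of_mul_nonpos_right hclose (by positivity)) (norm_nonneg _)
    rw [norm_eq_zero.1 h0, inner_zero_left, mul_zero]
    positivity
  set s := 4 * σ * ‖w‖ / μ ^ 2 with hs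
  have hspos : 0 < s := by positivity
  have hsμ : s * μ ^ 2 = 4 * (σ * ‖w‖) := by
    rw [hs]
    field_simp
  have hys : ‖y - p‖ < s := by
    have h1 : μ ^ 2 ≤ σ ^ 2 + 1 := by
      have : μ ^ 2 ≤ σ ^ 2 := by gcongr
      linarith
    have h2 : (σ ^ 2 + 1) * ‖y - p‖ < (σ ^ 2 + 1) * s := by
      have h3 : μ ^ 2 * s ≤ (σ ^ 2 + 1) * s := by gcongr
      have h4 : 0 < σ * ‖w‖ := by positivity
      linarith
    exact lt_of_mul_lt_mul_left h2 (by positivity)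
  have hfed := two_mul_inner_le_of_unique_nearest hM hunique h.1 hdist (hdist ▸ hys) hr hq
  have h1 : (σ ^ 2 + 1) * (2 * s * inner ℝ (y - p) (q - p))
      ≤ (σ ^ 2 + 1) * (‖y - p‖ * ‖q - p‖ ^ 2) := by gcongr
  have h2 : (σ ^ 2 + 1) * ‖y - p‖ * ‖q - p‖ ^ 2 ≤ s * μ ^ 2 / 4 * ‖q - p‖ ^ 2 := by
    gcongr
    linarith
  have h3 : 2 * s * ((σ ^ 2 + 1) * inner ℝ (y - p) (q - p))
      ≤ 2 * s * (μ ^ 2 / 8 * ‖q - p‖ ^ 2) := by linarith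
  exact le_of_mul_le_mul_left h3 (by positivity)

/-- The displacements between the minimizers for two admissible observations, in the quadratic
form of the reduced objective. -/
theorem IsReducedMin.norm_sq_add_le {μ L : ℝ} (hM : IsCompact M) (hA : IsBiLipschitzOn μ L A M)
    {x₁ x₂ : EuclideanSpace ℝ (Fin d)} {y₁ y₂ p₁ p₂ : EuclideanSpace ℝ (Fin n)}
    (hx₁ : x₁ ∈ admissibleSet M A μ L) (hx₂ : x₂ ∈ admissibleSet M A μ L)
    (h₁ : IsReducedMin M A (sigmaMax A ^ 2 + 1) x₁ y₁ p₁)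
    (h₂ : IsReducedMin M A (sigmaMax A ^ 2 + 1) x₂ y₂ p₂) :
    ‖A (y₂ - y₁)‖ ^ 2 + (sigmaMax A ^ 2 + 1) * ‖(y₂ - y₁) - (p₂ - p₁)‖ ^ 2
      ≤ 4 * ‖x₂ - x₁‖ ^ 2 := by
  have hγ : 0 < sigmaMax A ^ 2 + 1 := by positivity
  have hσγ : sigmaMax A ^ 2 ≤ sigmaMax A ^ 2 + 1 := by linarith
  have hlow := fun q₁ hq₁ q₂ hq₂ => (hA.2.2 q₁ hq₁ q₂ hq₂).1
  exact norm_sq_add_le_of_growth hγ.le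
    (h₁.quadratic_growth hγ hσγ hA.1 (norm_apply_le_sigmaMax A) hlow
      (fun q hq => h₁.curvature_le hM hA hx₁ hq) y₂ h₂.1)
    (h₂.quadratic_growth hγ hσγ hA.1 (norm_apply_le_sigmaMax A) hlow
      (fun q hq => h₂.curvature_le hM hA hx₂ hq) y₁ h₁.1)

/-- Lipschitz dependence of the minimizers of the reduced objective on the observation. -/
theorem IsReducedMin.norm_sq_sub_le {μ L : ℝ} (hM : IsCompact M) (hA : IsBiLipschitzOn μ L A M)
    {x₁ x₂ : EuclideanSpace ℝ (Fin d)} {y₁ y₂ p₁ p₂ : EuclideanSpace ℝ (Fin n)}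
    (hx₁ : x₁ ∈ admissibleSet M A μ L) (hx₂ : x₂ ∈ admissibleSet M A μ L)
    (h₁ : IsReducedMin M A (sigmaMax A ^ 2 + 1) x₁ y₁ p₁)
    (h₂ : IsReducedMin M A (sigmaMax A ^ 2 + 1) x₂ y₂ p₂) :
    ‖p₂ - p₁‖ ^ 2 ≤ 8 / μ ^ 2 * ‖x₂ - x₁‖ ^ 2 ∧
      ‖y₂ - y₁‖ ^ 2 ≤ (8 + 16 / μ ^ 2) * ‖x₂ - x₁‖ ^ 2 := by
  have hγ : 0 < sigmaMax A ^ 2 + 1 := by positivity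
  have hμ := hA.1
  have hS := IsReducedMin.norm_sq_add_le hM hA hx₁ hx₂ h₁ h₂
  have hp := sq_mul_norm_sq_le (le_add_of_nonneg_right zero_le_one) hμ (norm_apply_le_sigmaMax A) (v := p₂ - p₁)
    (by simpa using (hA.2.2 p₂ h₂.1 p₁ h₁.1).1) (y₂ - y₁)
  have hv : ‖p₂ - p₁‖ ^ 2 ≤ 8 / μ ^ 2 * ‖x₂ - x₁‖ ^ 2 := by
    rw [div_mul_eq_mul_div, le_div_iff₀ (by positivity)]
    linarith
  have huv : ‖(y₂ - y₁) - (p₂ - p₁)‖ ^ 2 ≤ 4 * ‖x₂ - x₁‖ ^ 2 := by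
    have : 0 ≤ sigmaMax A ^ 2 * ‖(y₂ - y₁) - (p₂ - p₁)‖ ^ 2 := by positivity
    have := sq_nonneg ‖A (y₂ - y₁)‖
    linarith
  refine ⟨hv, ?_⟩
  have htri : ‖y₂ - y₁‖ ≤ ‖(y₂ - y₁) - (p₂ - p₁)‖ + ‖p₂ - p₁‖ := by
    simpa using norm_add_le ((y₂ - y₁) - (p₂ - p₁)) (p₂ - p₁)
  have hsq : ‖y₂ - y₁‖ ^ 2 ≤ (‖(y₂ - y₁) - (p₂ - p₁)‖ + ‖p₂ - p₁‖) ^ 2 := by gcongr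
  have h16 : 16 / μ ^ 2 * ‖x₂ - x₁‖ ^ 2 = 2 * (8 / μ ^ 2 * ‖x₂ - x₁‖ ^ 2) := by ring
  nlinarith [sq_nonneg (‖(y₂ - y₁) - (p₂ - p₁)‖ - ‖p₂ - p₁‖)]

end Split

theorem theorem3p4 (n d k : ℕ) (M : Set (EuclideanSpace ℝ (Fin n)))
    (A : EuclideanSpace ℝ (Fin n) →ₗ[ℝ] EuclideanSpace ℝ (Fin d)) (μ L : ℝ)
    (hcompact : IsCompact M) (hsub : IsC2Submanifold k M) (hreach : 0 < reach M)
    (hA : IsBiLipschitzOn μ L A M) :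
    ∃ α β : ℝ, 0 < α ∧ 0 < β ∧
      (∀ x ∈ admissibleSet M A μ L,
        ∃! q : EuclideanSpace ℝ (Fin n) × EuclideanSpace ℝ (Fin n),
          IsMinOn (splitObjective M A α β x) Set.univ q) ∧
      (∀ F : EuclideanSpace ℝ (Fin d) → EuclideanSpace ℝ (Fin n),
        (∀ x ∈ admissibleSet M A μ L, ∃ z : EuclideanSpace ℝ (Fin n),
          IsMinOn (splitObjective M A α β x) Set.univ (F x, z)) →
        LocallyLipschitzOn (admissibleSet M A μ L) F) := by
  have hne := nonempty_of_reach_pos hreach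
  have hγ : 0 < sigmaMax A ^ 2 + 1 := by positivity
  refine ⟨2 * (sigmaMax A ^ 2 + 1), 2 * (sigmaMax A ^ 2 + 1), by positivity, by positivity,
    fun x hx => ?_, fun F hF => ?_⟩
  · obtain ⟨y, p, hmin⟩ := exists_isReducedMin (A := A) hcompact hne hγ x
    refine ⟨(y, (1 / 2 : ℝ) • (y + p)),
      (isMinOn_splitObjective_iff hcompact hne hγ).2 ⟨p, hmin, rfl⟩, ?_⟩
    rintro ⟨y', z'⟩ h'
    obtain ⟨p', hmin', rfl⟩ := (isMinOn_splitObjective_iff hcompact hne hγ).1 h'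
    obtain ⟨hp, hy⟩ := IsReducedMin.norm_sq_sub_le hcompact hA hx hx hmin hmin'
    rw [sub_self, norm_zero, zero_pow two_ne_zero, mul_zero] at hp hy
    have hp' : p' = p := by
      simpa [sub_eq_zero] using le_antisymm hp (sq_nonneg _)
    have hy' : y' = y := by
      simpa [sub_eq_zero] using le_antisymm hy (sq_nonneg _)
    rw [hp', hy']
  · have hLip : LipschitzOnWith (Real.toNNReal √(8 + 16 / μ ^ 2)) F (admissibleSet M A μ L) := by
      refine LipschitzOnWith.of_dist_le_mul fun x₂ hx₂ x₁ hx₁ => ?_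
      obtain ⟨z₁, h₁⟩ := hF x₁ hx₁
      obtain ⟨z₂, h₂⟩ := hF x₂ hx₂
      obtain ⟨p₁, hmin₁, -⟩ := (isMinOn_splitObjective_iff hcompact hne hγ).1 h₁
      obtain ⟨p₂, hmin₂, -⟩ := (isMinOn_splitObjective_iff hcompact hne hγ).1 h₂
      rw [Real.coe_toNNReal _ (Real.sqrt_nonneg _), dist_eq_norm, dist_eq_norm]
      refine (abs_le_of_sq_le_sq' ?_ (by positivity)).2
      rw [mul_pow, Real.sq_sqrt (by positivity)]
      exact (IsReducedMin.norm_sq_sub_le hcompact hA hx₁ hx₂ hmin₁ hmin₂).2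
    exact fun x _ => ⟨_, _, self_mem_nhdsWithin, hLip⟩
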